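/- Words are elements of $\{0,1\}^*$ and sequences are elements of $\{0,1\}^{\mathbb N}$; $\mu$ denotes the uniform (Lebesgue) product measure on $\{0,1\}^{\mathbb N}$, and for a language $L\subseteq\{0,1\}^*$, $[L]$ is the set of all sequences having a prefix in $L$. A family of languages $\mathcal U=(U_i)_{i\in I}$ with $I\subseteq\{0,1\}^*$ and $U_i\subseteq\{0,1\}^*$ is called automatic if $I$ is regular and the relation $\{(x,i): i\in I,\ x\in U_i\}$ is automatic, i.e. a deterministic finite automaton decides it by reading $x$ and $i$ synchronously, letter by letter, the shorter word being padded at its end with an extra symbol $\#$. An automatic family over an infinite index set $I$ is a Martin-Löf automatic randomness test (MART) if $\mu[U_i]\le 2^{-|i|}$ for all $i\in I$, and an automatic randomness test (ART) if $\liminf_{i\in I}\mu[U_i]=0$. A test covers $X$ if $X\in\bigcap_{i\in I}[U_i]$. A sequence is Martin-Löf automatic random (MAR) if it is covered by no MART, and automatic random (AR) if it is covered by no ART. A sequence is disjunctive if every word occurs in it as a block of consecutive letters. Theorem. There is a sequence that is Martin-Löf automatic random but not automatic random. More precisely, for every disjunctive sequence $A=A_1A_2A_3\ldots$, the sequence $A\oplus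 0^\omega=A_10A_20A_30\ldots$ is Martin-Löf automatic random but not automatic random. -/

import Mathlib

open MeasureTheory

noncomputable section

namespace AutomaticRandomness

/-- Words over `{0, 1}`; the letters `0` and `1` are `false` and `true`. -/
abbrev Word := List Bool

/-- The Cantor space of infinite binary sequences (`X n` is the letter in position `n + 1`). -/
abbrev Cantor := ℕ → Bool

/-- The word consisting of the first `n` letters of `X`. -/
def initialSegment (X : Cantor) (n : ℕ) : Word := (List.range n).map X

/-- The class `[L]` of all sequences that have a prefix in `L`. -/
def extensions (L : Language Bool) : Set Cantor := {X | ∃ n, initialSegment X n ∈ L}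

/-- The Lebesgue measure on the Cantor space: the infinite product of the uniform measure on
`{0, 1}`. -/
def lebesgue : Measure Cantor :=
  Measure.infinitePi fun _ : ℕ => (PMF.uniformOfFintype Bool).toMeasure

/-- A sequence is disjunctive if every word occurs in it as a block of consecutive letters. -/
def IsDisjunctive (X : Cantor) : Prop :=
  ∀ w : Word, ∃ n, (List.range w.length).map (fun j => X (n + j)) = w

/-- The convolution of two words: the word of pairs of letters whose length is the greater of the
two lengths, where the shorter word is filled up with the padding symbol `none`. -/
def convolution (x y : Word) : List (Option Bool × Option Bool) :=
  (List.range (max x.length y.length)).map fun n => (x[n]?, y[n]?)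

/-- A binary relation on words is automatic if some deterministic finite automaton recognizes,
among the convolutions of pairs of words, those of the pairs in the relation. -/
def IsAutomaticRel (R : Word → Word → Prop) : Prop :=
  ∃ (S : Type) (_ : Fintype S) (M : DFA (Option Bool × Option Bool) S),
    ∀ x y, R x y ↔ convolution x y ∈ M.accepts

/-- An automatic family of languages `(U i)`, `i ∈ I`. Values `U i` with `i ∉ I` play no role. -/
structure AutomaticFamily where
  /-- The index set. -/
  I : Language Bool
  /-- The languages of the family. -/
  U : Word → Language Bool
  isRegular_index : I.IsRegular
  isAutomaticRel_mem : IsAutomaticRel fun x i => i ∈ I ∧ x ∈ U i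

/-- A Martin-Löf automatic randomness test: an automatic family over an infinite index set with
`μ [U i] ≤ 2 ^ (-|i|)` for all indices `i`. -/
def AutomaticFamily.IsMART (𝓤 : AutomaticFamily) : Prop :=
  Set.Infinite {i : Word | i ∈ 𝓤.I} ∧
    ∀ i ∈ 𝓤.I, lebesgue (extensions (𝓤.U i)) ≤ (2 ^ i.length)⁻¹

/-- An automatic randomness test: an automatic family with `liminf μ [U i] = 0` over the indices
`i`. (Over a finite index set the limit inferior is that of an empty tail, hence `∞`, so the index
set of a test is infinite.) -/
def AutomaticFamily.IsART (𝓤 : AutomaticFamily) : Prop :=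
  Filter.liminf (fun i : {i : Word // i ∈ 𝓤.I} => lebesgue (extensions (𝓤.U i.1)))
    Filter.cofinite = 0

/-- The covering region of a family: the intersection of the classes `[U i]`. -/
def AutomaticFamily.coveringRegion (𝓤 : AutomaticFamily) : Set Cantor :=
  ⋂ i ∈ 𝓤.I, extensions (𝓤.U i)

/-- A sequence is Martin-Löf automatic random if no Martin-Löf automatic randomness test
covers it. -/
def IsMAR (X : Cantor) : Prop :=
  ∀ 𝓤 : AutomaticFamily, 𝓤.IsMART → X ∉ 𝓤.coveringRegion

/-- A sequence is automatic random if no automatic randomness test covers it. -/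
def IsAR (X : Cantor) : Prop :=
  ∀ 𝓤 : AutomaticFamily, 𝓤.IsART → X ∉ 𝓤.coveringRegion

/-- The join `A ⊕ B`, that is, the sequence `A₁ B₁ A₂ B₂ …`. -/
def join (A B : Cantor) : Cantor := fun n => if n % 2 = 0 then A (n / 2) else B (n / 2)

/-- The sequence `0 0 0 …`. -/
def zeroSeq : Cantor := fun _ => false

end AutomaticRandomness

end

noncomputable section

namespace AutomaticRandomness

/-! Every sequence that is not eventually periodic is Martin-Löf automatic random
(`isMAR_of_not_eventually_periodic`). By pumping, the index set of a test contains `u v^m w` for all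
`m`. Call a state live if some word, read against padding, leads from it to acceptance; such words
can be chosen of length at most a fixed `B`. The bound `2 ^ (-|i|)` then allows at most `2 ^ B`
words of length `|i|` that reach a live state. If the test covers `X`, its prefix of length `|i|` is
one of them. Two different loops of equal length along `v^d` at a state that `X` visits infinitely
often would yield exponentially many such words, so loops are unique and hence commute, which forces
`X` to be eventually periodic.

The join of a disjunctive sequence with `0^ω` is not eventually periodic. It is nevertheless covered
by the test that fixes every second letter up to length `|i|`: its measures tend to `0`, only too
slowly for a Martin-Löf test. -/

/-! ### Blocks of a sequence -/

/-- The block of `n` consecutive letters of `X` that starts in position `a`. -/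
def block (X : Cantor) (a n : ℕ) : Word := (List.range n).map fun j => X (a + j)

@[simp] lemma length_block (X : Cantor) (a n : ℕ) : (block X a n).length = n := by simp [block]

lemma initialSegment_eq_block (X : Cantor) (n : ℕ) : initialSegment X n = block X 0 n := by
  simp [initialSegment, block]

lemma block_add (X : Cantor) (a m n : ℕ) :
    block X a (m + n) = block X a m ++ block X (a + m) n := by
  simp [block, List.range_add, Function.comp_def, add_assoc]

lemma getElem?_block (X : Cantor) (a : ℕ) {n j : ℕ} (h : j < n) :
    (block X a n)[j]? = some (X (a + j)) := by
  simp [block, h]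

/-! ### Convolutions -/

/-- The convolution of two words, truncated to the length of the shorter one. -/
def pairs (y i : Word) : List (Option Bool × Option Bool) :=
  List.zipWith (fun a b => (some a, some b)) y i

lemma pairs_append {y i : Word} (h : y.length = i.length) (y' i' : Word) :
    pairs (y ++ y') (i ++ i') = pairs y i ++ pairs y' i' :=
  List.zipWith_append h

lemma convolution_cons (a b : Bool) (x y : Word) :
    convolution (a :: x) (b :: y) = (some a, some b) :: convolution x y := by
  simp only [convolution, List.length_cons, Nat.succ_max_succ, List.range_succ_eq_map]
  simp [Function.comp_def]

lemma convolution_nil_nil : convolution [] [] = [] := rfl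

lemma convolution_cons_nil (a : Bool) (x : Word) :
    convolution (a :: x) [] = (some a, none) :: convolution x [] := by
  simp only [convolution, List.length_cons, List.length_nil, Nat.max_zero,
    List.range_succ_eq_map]
  simp [Function.comp_def]

lemma convolution_nil_cons (b : Bool) (y : Word) :
    convolution [] (b :: y) = (none, some b) :: convolution [] y := by
  simp only [convolution, List.length_cons, List.length_nil, Nat.zero_max,
    List.range_succ_eq_map]
  simp [Function.comp_def]

lemma convolution_append {y i : Word} (h : y.length = i.length) (z : Word) :
    convolution (y ++ z) i = pairs y i ++ convolution z [] := by
  induction y generalizing i with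
  | nil => cases i <;> simp_all [pairs]
  | cons a y ih =>
    cases i with
    | nil => simp at h
    | cons b i =>
      rw [List.cons_append, convolution_cons, ih (by simpa using h)]
      rfl

/-! ### Automata with few live words along a periodic index -/

section Periodic

variable {S : Type} {M : DFA (Option Bool × Option Bool) S}

/-- The `m`-th power of a word. -/
def wordPow (v : Word) (m : ℕ) : Word := (List.replicate m v).flatten

@[simp] lemma length_wordPow (v : Word) (m : ℕ) : (wordPow v m).length = m * v.length := by
  simp [wordPow]

lemma wordPow_add (v : Word) (m n : ℕ) : wordPow v (m + n) = wordPow v m ++ wordPow v n := by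
  simp only [wordPow, List.replicate_add, List.flatten_append]

/-- The word `y`, read together with a power of `v` of the same length, leads back to `s`. -/
def IsLoop (M : DFA (Option Bool × Option Bool) S) (v : Word) (s : S) (d : ℕ) (y : Word) : Prop :=
  y.length = d * v.length ∧ M.evalFrom s (pairs y (wordPow v d)) = s

lemma IsLoop.append {v : Word} {s : S} {d e : ℕ} {y z : Word} (hy : IsLoop M v s d y)
    (hz : IsLoop M v s e z) : IsLoop M v s (d + e) (y ++ z) := by
  refine ⟨by simp [hy.1, hz.1, add_mul], ?_⟩
  rw [wordPow_add, pairs_append (by simp [hy.1]), DFA.evalFrom_of_append, hy.2, hz.2]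

/-- Different words of equal length generate freely, so the products of `r` factors `y` or `z` are
pairwise distinct loops. -/
lemma exists_loops {v : Word} {s : S} {d : ℕ} {y z : Word} (hy : IsLoop M v s d y)
    (hz : IsLoop M v s d z) (hne : y ≠ z) (r : ℕ) :
    ∃ G : Finset Word, G.card = 2 ^ r ∧ ∀ g ∈ G, IsLoop M v s (r * d) g := by
  classical
  induction r with
  | zero => exact ⟨{[]}, by simp, by simp [IsLoop, pairs, wordPow]⟩
  | succ r ih =>
    obtain ⟨G, hc, hG⟩ := ih
    refine ⟨G.image (y ++ ·) ∪ G.image (z ++ ·), ?_, ?_⟩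
    · rw [Finset.card_union_of_disjoint, Finset.card_image_of_injective _
        (List.append_right_injective y), Finset.card_image_of_injective _
        (List.append_right_injective z), hc, pow_succ, mul_two]
      rw [Finset.disjoint_left]
      rintro x hx hx'
      obtain ⟨g, -, rfl⟩ := Finset.mem_image.1 hx
      obtain ⟨g', -, h⟩ := Finset.mem_image.1 hx'
      exact hne (List.append_inj_left h (hz.1.trans hy.1.symm)).symm
    · have e : (r + 1) * d = d + r * d := by ring
      intro g hg
      rw [e]
      rcases Finset.mem_union.1 hg with hg | hg
      · obtain ⟨g, h, rfl⟩ := Finset.mem_image.1 hg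
        exact hy.append (hG g h)
      · obtain ⟨g, h, rfl⟩ := Finset.mem_image.1 hg
        exact hz.append (hG g h)

/-- `hX` says that `X` stays live along the indices `u v^m w`, `hK` that at most `K` words of
matching length do. -/
lemma eventually_periodic_of_card_le [Finite S] {X : Cantor} {u v w : Word} (hv : v ≠ [])
    {live : Set S} {K : ℕ}
    (hX : ∀ m, M.eval (pairs (block X 0 (u ++ wordPow v m ++ w).length)
      (u ++ wordPow v m ++ w)) ∈ live)
    (hK : ∀ m, ∀ F : Finset Word, (∀ y ∈ F, y.length = (u ++ wordPow v m ++ w).length ∧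
      M.eval (pairs y (u ++ wordPow v m ++ w)) ∈ live) → F.card ≤ K) :
    ∃ c > 0, ∃ N, ∀ n ≥ N, X (n + c) = X n := by
  classical
  have hp : 0 < v.length := List.length_pos_iff.2 hv
  set p := v.length
  -- `q j` is the state after `X` has been read along `u v^j`; a value `s` taken infinitely often
  -- gives arbitrarily long loops.
  set q : ℕ → S := fun j => M.eval (pairs (block X 0 (u.length + j * p)) (u ++ wordPow v j)) with hq
  have hstep (j d) : q (j + d) = M.evalFrom (q j)
      (pairs (block X (u.length + j * p) (d * p)) (wordPow v d)) := by
    have e : u.length + (j + d) * p = u.length + j * p + d * p := by ring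
    simp only [hq, DFA.eval]
    rw [e, block_add, wordPow_add, ← List.append_assoc, pairs_append (by simp [p]),
      DFA.evalFrom_of_append, zero_add]
  obtain ⟨s, hs⟩ := Finite.exists_infinite_fiber q
  have hs : (q ⁻¹' {s}).Infinite := Set.infinite_coe_iff.1 hs
  obtain ⟨t, ht⟩ := hs.nonempty
  have ht : q t = s := ht
  have hloop (d) (h : q (t + d) = s) : IsLoop M v s d (block X (u.length + t * p) (d * p)) :=
    ⟨by simp [p], by rw [← ht, ← hstep, h, ht]⟩
  -- Otherwise `2 ^ K > K` loops can be inserted at time `t`, each followed by the letters that `X`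
  -- itself reads along `w` from `s`, so that all results are live.
  have hcomm {d y z} (hy : IsLoop M v s d y) (hz : IsLoop M v s d z) : y = z := by
    by_contra hne
    obtain ⟨G, hc, hG⟩ := exists_loops hy hz hne K
    have hinj : Function.Injective fun g : Word =>
        block X 0 (u.length + t * p) ++ g ++ block X (u.length + t * p) w.length :=
      (List.append_left_injective _).comp (List.append_right_injective _)
    have := hK (t + K * d) (G.image fun g =>
        block X 0 (u.length + t * p) ++ g ++ block X (u.length + t * p) w.length) (by
      intro y hy
      obtain ⟨g, hg, rfl⟩ := Finset.mem_image.1 hy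
      obtain ⟨hl, he⟩ := hG g hg
      refine ⟨by simp [hl, p]; ring, ?_⟩
      have h1 := hX t
      have e : (u ++ wordPow v t ++ w).length = u.length + t * p + w.length := by simp [p]; ring
      rw [e, block_add, pairs_append (by simp [p]), DFA.eval, DFA.evalFrom_of_append] at h1
      rw [wordPow_add, ← List.append_assoc, pairs_append (by simp [hl, p, add_assoc]),
        pairs_append (by simp [p]), DFA.eval, DFA.evalFrom_of_append, DFA.evalFrom_of_append]
      have h2 : M.evalFrom M.start (pairs (block X 0 (u.length + t * p)) (u ++ wordPow v t)) = s :=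
        ht
      rw [h2, he]
      rw [h2, zero_add] at h1
      exact h1)
    rw [Finset.card_image_of_injective _ hinj, hc] at this
    exact absurd this (not_le.2 Nat.lt_two_pow_self)
  obtain ⟨t', ht', hlt⟩ := hs.exists_gt t
  obtain ⟨c, rfl⟩ := Nat.exists_eq_add_of_lt hlt
  have hc := hloop (c + 1) ht'
  refine ⟨(c + 1) * p, by positivity, u.length + t * p, fun n hn => ?_⟩
  obtain ⟨k, rfl⟩ := Nat.exists_eq_add_of_le hn
  -- A second return to `s`, late enough for its loop to contain position `k + (c + 1) * p`.
  -- Comparing the two orders of concatenation there gives the period `(c + 1) * p`.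
  obtain ⟨t'', ht'', hlt''⟩ := hs.exists_gt (t + (k + (c + 1) * p))
  obtain ⟨e, rfl⟩ := Nat.exists_eq_add_of_lt hlt''
  set f := k + (c + 1) * p + e + 1 with hf
  have he := hloop f (by rw [← (show q _ = s from ht'')]; congr 1; omega)
  have hfp : f ≤ f * p := Nat.le_mul_of_pos_right _ hp
  have key := hcomm (hc.append he) (add_comm f (c + 1) ▸ he.append hc)
  have := congrArg (·[k + (c + 1) * p]?) key
  rw [List.getElem?_append_right (by simp), List.getElem?_append_left (by simp; omega),
    length_block, Nat.add_sub_cancel, getElem?_block _ _ (by omega),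
    getElem?_block _ _ (by omega)] at this
  rw [add_assoc]
  exact (Option.some.inj this).symm

end Periodic

/-! ### Disjunctive sequences -/

lemma IsDisjunctive.not_eventually_periodic {A : Cantor} (hA : IsDisjunctive A) {c : ℕ} (hc : 0 < c) (N : ℕ) :
    ¬ ∀ n ≥ N, A (n + c) = A n := by
  intro h
  -- Wherever this word occurs, its positions `N` and `N + c` lie beyond `N` in `A` and carry
  -- different letters.
  obtain ⟨n, hn⟩ := hA (List.replicate (N + c) false ++ List.replicate (c + 1) true)
  have key (j : ℕ) (hj : j < N + c + (c + 1)) := congrArg (·[j]?) hn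
  simp only [List.length_append, List.length_replicate, List.getElem?_map] at key
  have h1 := key (N + c) (by omega)
  have h2 := key N (by omega)
  rw [List.getElem?_append_right (by simp), List.getElem?_range (by omega)] at h1
  rw [List.getElem?_append_left (by simp; omega), List.getElem?_range (by omega)] at h2
  have := h (n + N) (by omega)
  simp_all [add_assoc]

lemma exists_testBit_eq (w : Word) : ∃ m : ℕ, ∀ j (h : j < w.length), m.testBit j = w[j] := by
  induction w with
  | nil => exact ⟨0, by simp⟩
  | cons a w ih =>
    obtain ⟨m, hm⟩ := ih
    refine ⟨Nat.bit a m, fun j h => ?_⟩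
    cases j with
    | zero => simp
    | succ j => simpa [Nat.testBit_bit_succ] using hm j (by simpa using h)

lemma exists_isDisjunctive : ∃ A : Cantor, IsDisjunctive A := by
  -- The positions from `2 ^ m` to `2 ^ (m + 1) - 1` list binary digits of `m`, lowest first. The
  -- `true` appended to `w` below makes `m` large enough for `w` to fit there.
  refine ⟨fun n => (Nat.log 2 n).testBit (n - 2 ^ Nat.log 2 n), fun w => ?_⟩
  obtain ⟨m, hm⟩ := exists_testBit_eq (w ++ [true])
  have hle : 2 ^ w.length ≤ m := Nat.ge_two_pow_of_testBit (by simpa using hm w.length (by simp))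
  have h1 : w.length < 2 ^ w.length := Nat.lt_two_pow_self
  have h2 : m < 2 ^ m := Nat.lt_two_pow_self
  refine ⟨2 ^ m, List.ext_getElem (by simp) fun j hj hj' => ?_⟩
  have hlog : Nat.log 2 (2 ^ m + j) = m :=
    (Nat.log_eq_iff (Or.inr ⟨by norm_num, by positivity⟩)).2 ⟨by omega, by rw [pow_succ]; omega⟩
  simp only [List.getElem_map, List.getElem_range, hlog, Nat.add_sub_cancel_left]
  rw [hm j (by simp; omega), List.getElem_append_left]

lemma IsDisjunctive.join_not_eventually_periodic {A : Cantor} (hA : IsDisjunctive A) (B : Cantor)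
    {c : ℕ} (hc : 0 < c) (N : ℕ) : ¬ ∀ n ≥ N, join A B (n + c) = join A B n := by
  intro h
  -- Doubling the period makes it even, so it passes to `A`.
  have h2 (n) (hn : n ≥ N) : join A B (n + 2 * c) = join A B n := by
    rw [two_mul, ← add_assoc, h _ (by omega), h _ hn]
  refine hA.not_eventually_periodic hc N fun n hn => ?_
  have := h2 (2 * n) (by omega)
  rw [← mul_add] at this
  simpa [join] using this

/-! ### The measure of cylinders -/

instance : IsProbabilityMeasure lebesgue := by unfold lebesgue; infer_instance

lemma lebesgue_pi (s : Finset ℕ) (X : Cantor) :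
    lebesgue (Set.pi s fun j => {X j}) = (2 ^ s.card)⁻¹ := by
  rw [lebesgue, Measure.infinitePi_pi _ fun _ _ => MeasurableSet.singleton _]
  simp [ENNReal.inv_pow]

/-- The class of all sequences with prefix `y`. -/
def cylinder (y : Word) : Set Cantor := {X | initialSegment X y.length = y}

lemma cylinder_eq_pi (y : Word) :
    cylinder y = Set.pi (Finset.range y.length) fun j => {y.getD j false} := by
  ext X
  simp only [cylinder, Set.mem_ofPred_eq, Set.mem_pi, Finset.coe_range, Set.mem_Iio,
    Set.mem_singleton_iff]
  constructor
  · intro h j hj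
    have := congrArg (·[j]?) h
    simp only [initialSegment, List.getElem?_map, List.getElem?_range hj] at this
    simp [List.getD, ← this]
  · intro h
    refine List.ext_getElem (by simp [initialSegment]) fun j hj hj' => ?_
    simp [initialSegment, h j hj', List.getD, hj']

lemma lebesgue_cylinder (y : Word) : lebesgue (cylinder y) = (2 ^ y.length)⁻¹ := by
  rw [cylinder_eq_pi, lebesgue_pi (Finset.range y.length) fun j => y.getD j false,
    Finset.card_range]

lemma measurableSet_cylinder (y : Word) : MeasurableSet (cylinder y) := by
  rw [cylinder_eq_pi]
  exact MeasurableSet.pi (Finset.countable_toSet _) fun _ _ => MeasurableSet.singleton _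

lemma cylinder_subset_extensions {L : Language Bool} {y : Word} (h : y ∈ L) :
    cylinder y ⊆ extensions L := fun X hX => ⟨y.length, by rwa [show initialSegment X y.length = y from hX]⟩

lemma cylinder_append_subset (y z : Word) : cylinder (y ++ z) ⊆ cylinder y := by
  intro X hX
  have hX : initialSegment X (y ++ z).length = y ++ z := hX
  rw [initialSegment_eq_block, List.length_append, block_add] at hX
  rw [cylinder, Set.mem_ofPred_eq, initialSegment_eq_block]
  exact List.append_inj_left hX (by simp)

lemma disjoint_cylinder {y y' : Word} (hl : y.length = y'.length) (hne : y ≠ y') :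
    Disjoint (cylinder y) (cylinder y') := by
  rw [Set.disjoint_left]
  intro X hX hX'
  rw [cylinder, Set.mem_ofPred_eq] at hX hX'
  exact hne (by rw [← hX, hl, hX'])

/-- If all words of a finite set have length `n` and extend by at most `B` letters to a word of
`L`, then `L` has measure at least the size of the set times `2 ^ (-(n + B))`. -/
lemma card_le_of_lebesgue_le {L : Language Bool} {n B : ℕ}
    (hL : lebesgue (extensions L) ≤ (2 ^ n)⁻¹) (F : Finset Word)
    (hF : ∀ y ∈ F, y.length = n ∧ ∃ z : Word, z.length ≤ B ∧ y ++ z ∈ L) : F.card ≤ 2 ^ B := by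
  classical
  choose! z hz using fun y hy => (hF y hy).2
  have hdisj : (F : Set Word).PairwiseDisjoint fun y => cylinder (y ++ z y) := by
    intro y hy y' hy' hne
    exact (disjoint_cylinder ((hF y hy).1.trans (hF y' hy').1.symm) hne).mono
      (cylinder_append_subset _ _) (cylinder_append_subset _ _)
  have h1 : lebesgue (⋃ y ∈ F, cylinder (y ++ z y)) ≤ (2 ^ n)⁻¹ :=
    (measure_mono (Set.iUnion₂_subset fun y hy =>
      cylinder_subset_extensions (hz y hy).2)).trans hL
  rw [measure_biUnion_finset hdisj fun _ _ => measurableSet_cylinder _] at h1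
  have h2 : ∑ y ∈ F, ((2 : ENNReal) ^ (n + B))⁻¹ ≤ ∑ y ∈ F, lebesgue (cylinder (y ++ z y)) := by
    refine Finset.sum_le_sum fun y hy => ?_
    rw [lebesgue_cylinder, ENNReal.inv_le_inv, List.length_append, (hF y hy).1]
    exact pow_le_pow_right₀ (by norm_num) (by have := (hz y hy).1; omega)
  have h3 := h2.trans h1
  rw [Finset.sum_const, nsmul_eq_mul, ← div_eq_mul_inv,
    ENNReal.div_le_iff (by positivity) (by finiteness), pow_add, ← mul_assoc,
    ENNReal.inv_mul_cancel (by positivity) (by finiteness), one_mul] at h3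
  exact_mod_cast h3

/-- The cylinder of a single shorter word would already be too large. -/
lemma le_of_mem_of_lebesgue_le {L : Language Bool} {n : ℕ}
    (hL : lebesgue (extensions L) ≤ (2 ^ n)⁻¹) {y : Word} (hy : y ∈ L) : n ≤ y.length := by
  have := (measure_mono (cylinder_subset_extensions hy)).trans hL
  rw [lebesgue_cylinder, ENNReal.inv_le_inv] at this
  exact (Nat.pow_le_pow_iff_right one_lt_two).1 (by exact_mod_cast this)

/-! ### Sequences that are not eventually periodic are Martin-Löf automatic random -/

lemma exists_infinite_wordPow {I : Language Bool} (hI : I.IsRegular)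
    (hinf : Set.Infinite {i : Word | i ∈ I}) :
    ∃ u v w : Word, v ≠ [] ∧ ∀ m, u ++ wordPow v m ++ w ∈ I := by
  obtain ⟨σ, _, M, rfl⟩ := hI
  have : ∃ x ∈ M.accepts, Fintype.card σ ≤ x.length := by
    -- Only finitely many words are shorter than the number of states.
    by_contra! h
    exact hinf ((List.finite_length_lt Bool (Fintype.card σ)).subset fun x hx => h x hx)
  obtain ⟨x, hx, hl⟩ := this
  obtain ⟨u, v, w, -, -, hv, h⟩ := M.pumping_lemma hx hl
  refine ⟨u, v, w, hv, fun m => h ?_⟩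
  exact Language.append_mem_mul (Language.append_mem_mul rfl
    (Language.join_mem_kstar fun y hy => List.eq_of_mem_replicate hy)) rfl

lemma isMAR_of_not_eventually_periodic {X : Cantor}
    (hX : ∀ c > 0, ∀ N, ¬ ∀ n ≥ N, X (n + c) = X n) : IsMAR X := by
  intro 𝓤 ⟨hinf, hμ⟩ hcov
  obtain ⟨u, v, w, hv, hI⟩ := exists_infinite_wordPow 𝓤.isRegular_index hinf
  obtain ⟨S, _, M, hM⟩ := 𝓤.isAutomaticRel_mem
  let live : Set S := {s | ∃ z : Word, M.evalFrom s (convolution z []) ∈ M.accept}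
  -- Once the index is exhausted, acceptance depends only on the state reached and on `z`.
  have hmem {y i z : Word} (h : y.length = i.length) : (i ∈ 𝓤.I ∧ y ++ z ∈ 𝓤.U i) ↔
      M.evalFrom (M.eval (pairs y i)) (convolution z []) ∈ M.accept := by
    refine (hM _ _).trans ?_
    rw [convolution_append h, DFA.mem_accepts, DFA.eval, DFA.evalFrom_of_append]
  have hB : ∃ B, ∀ s ∈ live, ∃ z : Word, z.length ≤ B ∧
      M.evalFrom s (convolution z []) ∈ M.accept := by
    choose! z hz using fun s (hs : s ∈ live) => hs
    exact ⟨Finset.univ.sup fun s => (z s).length, fun s hs =>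
      ⟨z s, Finset.le_sup (f := fun s => (z s).length) (Finset.mem_univ s), hz s hs⟩⟩
  obtain ⟨B, hB⟩ := hB
  obtain ⟨c, hc, N, h⟩ := eventually_periodic_of_card_le (M := M) (X := X) (u := u) (w := w) hv
    (live := live) (K := 2 ^ B) (fun m => by
      obtain ⟨n, hn⟩ := Set.mem_iInter₂.1 hcov _ (hI m)
      have hle := le_of_mem_of_lebesgue_le (hμ _ (hI m)) hn
      rw [initialSegment_eq_block] at hn hle
      rw [length_block] at hle
      obtain ⟨k, rfl⟩ := Nat.exists_eq_add_of_le hle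
      rw [block_add] at hn
      exact ⟨_, (hmem (length_block _ _ _)).1 ⟨hI m, hn⟩⟩)
    (fun m F hF => card_le_of_lebesgue_le (hμ _ (hI m)) F fun y hy => by
      obtain ⟨hl, hlive⟩ := hF y hy
      obtain ⟨z, hz, hacc⟩ := hB _ hlive
      exact ⟨hl, z, hz, ((hmem hl).2 hacc).2⟩)
  exact hX c hc N h

/-! ### A test that covers all joins with the zero sequence -/

/-- The words with the letter `0` in every second position; the first letter is constrained if
and only if `p` is true. -/
def AlternatelyZero : Bool → Word → Prop
  | _, [] => True
  | p, a :: x => (p = true → a = false) ∧ AlternatelyZero (!p) x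

/-- An automaton that checks that two words have the same length and that the first one is `0` in
every second position. The state `none` is the rejecting sink, and in the state `some p` the next
letter of the first word is constrained if and only if `p` is true. -/
def alternatelyZeroDFA : DFA (Option Bool × Option Bool) (Option Bool) where
  step
    | some p, (some a, some _) => if p && a then none else some !p
    | _, _ => none
  start := some false
  accept := {s | s ≠ none}

lemma evalFrom_none (l : List (Option Bool × Option Bool)) :
    alternatelyZeroDFA.evalFrom none l = none := by
  induction l with
  | nil => rfl
  | cons a l ih => exact ih

lemma alternatelyZeroDFA_evalFrom (p : Bool) (x i : Word) :
    alternatelyZeroDFA.evalFrom (some p) (convolution x i) ≠ none ↔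
      x.length = i.length ∧ AlternatelyZero p x := by
  induction x generalizing p i with
  | nil =>
    cases i with
    | nil => simp [convolution_nil_nil, AlternatelyZero]
    | cons b i =>
      rw [convolution_nil_cons, DFA.evalFrom_cons]
      exact iff_of_false (not_not.2 (evalFrom_none _)) (by simp)
  | cons a x ih =>
    cases i with
    | nil =>
      rw [convolution_cons_nil, DFA.evalFrom_cons]
      exact iff_of_false (not_not.2 (evalFrom_none _)) (by simp)
    | cons b i =>
      rw [convolution_cons, DFA.evalFrom_cons, List.length_cons, List.length_cons,
        Nat.add_right_cancel_iff, AlternatelyZero]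
      by_cases h : p = true ∧ a = true
      · obtain ⟨rfl, rfl⟩ := h
        exact iff_of_false (not_not.2 (evalFrom_none _)) (by simp)
      · have e : alternatelyZeroDFA.step (some p) (some a, some b) = some !p :=
          if_neg (by simpa using h)
        rw [e, ih]
        cases a <;> simp_all

/-- The family of the languages of all words of the length of the index with the letter `0` in
every even position. -/
def alternatelyZeroFamily : AutomaticFamily where
  I := ⊤
  U i := {x | x.length = i.length ∧ AlternatelyZero false x}
  isRegular_index := ⟨Unit, inferInstance, ⟨fun _ _ => (), (), Set.univ⟩, by
    ext x; exact ⟨fun _ => trivial, fun _ => Set.mem_univ _⟩⟩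
  isAutomaticRel_mem := ⟨Option Bool, inferInstance, alternatelyZeroDFA, fun x i =>
    (and_iff_right trivial).trans (alternatelyZeroDFA_evalFrom false x i).symm⟩

lemma AlternatelyZero.getElem_eq_false {p : Bool} {x : Word} (h : AlternatelyZero p x) {j : ℕ}
    (hj : j < x.length) (hp : j % 2 = cond p 0 1) : x[j] = false := by
  induction x generalizing p j with
  | nil => simp at hj
  | cons a x ih =>
    cases j with
    | zero => cases p <;> simp_all [AlternatelyZero]
    | succ j =>
      rw [List.getElem_cons_succ]
      exact ih h.2 (by simpa using hj) (by cases p <;> simp_all <;> omega)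

lemma alternatelyZero_block {X : Cantor} {a : ℕ} {p : Bool} (n : ℕ)
    (h : ∀ j, j % 2 = cond p 0 1 → X (a + j) = false) : AlternatelyZero p (block X a n) := by
  induction n generalizing a p with
  | zero => trivial
  | succ n ih =>
    have e : block X a (n + 1) = X a :: block X (a + 1) n := by
      rw [add_comm, block_add]; simp [block]
    rw [e]
    refine ⟨fun hp => h 0 (by simp [hp]), ih fun j hj => ?_⟩
    rw [add_assoc]
    exact h _ (by cases p <;> simp_all <;> omega)

lemma join_zeroSeq_mem_coveringRegion (A : Cantor) :
    join A zeroSeq ∈ alternatelyZeroFamily.coveringRegion := by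
  refine Set.mem_iInter₂.2 fun i _ => ⟨i.length, ?_⟩
  rw [initialSegment_eq_block]
  exact ⟨length_block _ _ _, alternatelyZero_block _ fun j hj => by
    have hj : j % 2 = 1 := hj
    simp [join, hj, zeroSeq]⟩

lemma lebesgue_alternatelyZeroFamily_le (i : Word) :
    lebesgue (extensions (alternatelyZeroFamily.U i)) ≤ 2⁻¹ ^ (i.length / 2) := by
  -- The zero-based odd positions below `i.length`, where the letter must be `0`.
  let s : Finset ℕ := (Finset.range (i.length / 2)).image (2 * · + 1)
  have hs : s.card = i.length / 2 := by
    rw [Finset.card_image_of_injective _ fun a b h => by simpa using h, Finset.card_range]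
  rw [← hs, ← ENNReal.inv_pow, ← lebesgue_pi s zeroSeq]
  refine measure_mono fun X hX => ?_
  obtain ⟨n, hl, h⟩ := hX
  have hn : n = i.length := by simpa [initialSegment] using hl
  intro j hj
  obtain ⟨k, hk, rfl⟩ := Finset.mem_image.1 (Finset.mem_coe.1 hj)
  have hk := Finset.mem_range.1 hk
  have := h.getElem_eq_false (j := 2 * k + 1) (by omega) (by simp)
  simpa [initialSegment, zeroSeq] using this

lemma alternatelyZeroFamily_isART : alternatelyZeroFamily.IsART := by
  have : Infinite {i : Word // i ∈ alternatelyZeroFamily.I} :=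
    Infinite.of_injective (fun i : Word => ⟨i, trivial⟩) fun a b h => congrArg Subtype.val h
  have hlen : Filter.Tendsto (fun i : {i : Word // i ∈ alternatelyZeroFamily.I} =>
      i.1.length / 2) Filter.cofinite Filter.atTop := by
    refine Filter.tendsto_atTop.2 fun b => ?_
    rw [Filter.eventually_cofinite]
    refine ((List.finite_length_lt Bool (2 * b)).preimage
      Subtype.val_injective.injOn).subset fun i hi => ?_
    simp only [Set.mem_ofPred_eq, Set.mem_preimage] at hi ⊢
    omega
  exact (tendsto_of_tendsto_of_tendsto_of_le_of_le tendsto_const_nhds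
    ((ENNReal.tendsto_pow_atTop_nhds_zero_of_lt_one (by simp)).comp hlen)
    (fun _ => zero_le) fun i => lebesgue_alternatelyZeroFamily_le i.1).liminf_eq

lemma isMAR_and_not_isAR_join_zeroSeq {A : Cantor} (hA : IsDisjunctive A) :
    IsMAR (join A zeroSeq) ∧ ¬ IsAR (join A zeroSeq) :=
  ⟨isMAR_of_not_eventually_periodic fun _ hc N => hA.join_not_eventually_periodic zeroSeq hc N,
    fun h => h _ alternatelyZeroFamily_isART (join_zeroSeq_mem_coveringRegion A)⟩

end AutomaticRandomness

end

theorem theorem11 :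
    (∃ X : AutomaticRandomness.Cantor,
      AutomaticRandomness.IsMAR X ∧ ¬ AutomaticRandomness.IsAR X) ∧
    ∀ A : AutomaticRandomness.Cantor, AutomaticRandomness.IsDisjunctive A →
      AutomaticRandomness.IsMAR
          (AutomaticRandomness.join A AutomaticRandomness.zeroSeq) ∧
        ¬ AutomaticRandomness.IsAR
          (AutomaticRandomness.join A AutomaticRandomness.zeroSeq) := by
  refine ⟨?_, fun A hA => AutomaticRandomness.isMAR_and_not_isAR_join_zeroSeq hA⟩
  obtain ⟨A, hA⟩ := AutomaticRandomness.exists_isDisjunctive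
  exact ⟨_, AutomaticRandomness.isMAR_and_not_isAR_join_zeroSeq hA⟩
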